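/- Let $p$ be a prime number and let $C\subset \mathrm{GL}_2(\mathbb F_p)$ be a non-split Cartan subgroup, i.e. the group of units of a subalgebra of $M_2(\mathbb F_p)$ that is a field with $p^2$ elements. Let $\Gamma_{ns}(p)$ be the group of all $\gamma\in\mathrm{SL}_2(\mathbb Z)$ whose reduction modulo $p$ lies in $C$, let $X_{ns}(p)$ be the modular curve whose complex points are the compact Riemann surface $(\mathcal H\cup\mathbb Q\cup\{\infty\})/\Gamma_{ns}(p)$, let $\mathrm{Norm}(\Gamma_{ns}(p))$ be the normalizer of $\Gamma_{ns}(p)$ in $\mathrm{SL}_2(\mathbb R)$, and let $B(X_{ns}(p))=\mathrm{Norm}(\Gamma_{ns}(p))/\Gamma_{ns}(p)$ be the group of modular automorphisms. Suppose that the genus of $X_{ns}(p)$ is at least $2$. Then: 1. $\mathrm{Norm}(\Gamma_{ns}(p))\subset \mathrm{SL}_2(\mathbb Z)$, and $\mathrm{Norm}(\Gamma_{ns}(p))$ consists exactly of the matrices in $\mathrm{SL}_2(\mathbb Z)$ whose reduction modulo $p$ lies in the normalizer $N(C)$ of $C$ in $\mathrm{GL}_2(\mathbb F_p)$. 2. The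 natural homomorphism $B(X_{ns}(p))\to\mathrm{Aut}(X_{ns}(p))$, induced by the action of $\mathrm{Norm}(\Gamma_{ns}(p))$ by Möbius transformations, is injective. There are matrices in $\mathrm{SL}_2(\mathbb Z)$ whose reduction modulo $p$ lies in $N(C)\setminus C$; all of them have the same class $w$ in $B(X_{ns}(p))$. This class $w$ (the modular involution) has order $2$, and $B(X_{ns}(p))=\langle w\rangle$, both as a group and as a subgroup of $\mathrm{Aut}(X_{ns}(p))$. -/

import Mathlib

open scoped MatrixGroups Manifold
open Matrix Matrix.SpecialLinearGroup

noncomputable section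

namespace ModularCurve

/-! ### Non-split Cartan subgroups and the groups `Γ_H` -/

/-- A non-split Cartan subgroup of `GL₂(𝔽_p)`: the group of units of a subalgebra of `M₂(𝔽_p)`
which is a field with `p²` elements. -/
def IsNonsplitCartan {p : ℕ} (C : Subgroup (GL (Fin 2) (ZMod p))) : Prop :=
  ∃ K : Subalgebra (ZMod p) (Matrix (Fin 2) (Fin 2) (ZMod p)),
    IsField K ∧ Nat.card K = p ^ 2 ∧
      ∀ g : GL (Fin 2) (ZMod p), g ∈ C ↔ (g : Matrix (Fin 2) (Fin 2) (ZMod p)) ∈ K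

/-- Reduction modulo `N`, `SL₂(ℤ) → GL₂(ℤ/N)`. -/
def reduction (N : ℕ) : SL(2, ℤ) →* GL (Fin 2) (ZMod N) :=
  toGL.comp (SpecialLinearGroup.map (Int.castRingHom (ZMod N)))

/-- The inclusion `SL₂(ℤ) → SL₂(ℝ)`. -/
def intToReal : SL(2, ℤ) →* SL(2, ℝ) :=
  SpecialLinearGroup.map (Int.castRingHom ℝ)

/-- `Γ_H`, the group of all `γ ∈ SL₂(ℤ)` whose reduction modulo `N` lies in `H`,
as a subgroup of `SL₂(ℝ)`. -/
def levelGroup {N : ℕ} (H : Subgroup (GL (Fin 2) (ZMod N))) : Subgroup SL(2, ℝ) :=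
  (H.comap (reduction N)).map intToReal

/-- The normalizer of `Γ` in `SL₂(ℝ)`. -/
abbrev Norm (Γ : Subgroup SL(2, ℝ)) : Subgroup SL(2, ℝ) :=
  Subgroup.normalizer (Γ : Set SL(2, ℝ))

/-! ### The extended upper half plane -/

/-- The upper half plane together with the cusps of `Γ`. For the groups `Γ_H` the cusps are
exactly the points of `ℚ ∪ {∞}`, see `isCusp_levelGroup_iff`. -/
inductive ExtendedHalfPlane (Γ : Subgroup SL(2, ℝ)) : Type
  | pt (τ : UpperHalfPlane) : ExtendedHalfPlane Γ
  | cusp (c : OnePoint ℝ) (hc : IsCusp c (Γ.map toGL)) : ExtendedHalfPlane Γ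

theorem isCusp_levelGroup_iff {N : ℕ} [NeZero N] (H : Subgroup (GL (Fin 2) (ZMod N)))
    (c : OnePoint ℝ) :
    IsCusp c ((levelGroup H).map toGL) ↔ c ∈ Set.range (OnePoint.map ((↑) : ℚ → ℝ)) := by
  have h1 : (levelGroup H).map toGL = (H.comap (reduction N)).map (mapGL ℝ) := by
    rw [levelGroup, Subgroup.map_map]; rfl
  have h2 : CongruenceSubgroup.Gamma N ≤ H.comap (reduction N) := by
    intro γ hγ
    have : SpecialLinearGroup.map (Int.castRingHom (ZMod N)) γ = 1 :=
      CongruenceSubgroup.Gamma_mem'.1 hγ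
    simp [reduction, this, H.one_mem]
  have h3 : (H.comap (reduction N)).FiniteIndex :=
    CongruenceSubgroup.IsCongruenceSubgroup.finiteIndex ⟨N, NeZero.ne N, h2⟩
  rw [h1, Subgroup.IsArithmetic.isCusp_iff_isCusp_SL2Z, isCusp_SL2Z_iff]

namespace ExtendedHalfPlane

variable {Γ : Subgroup SL(2, ℝ)}

/-- The horoball topology: `U` is open if its trace on the upper half plane is open and if, for
each cusp `c ∈ U` and each `g ∈ SL₂(ℝ)` with `g ∞ = c`, the set `U` contains the horoball
`g {τ | A < Im τ}` for some `A`. -/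
instance : TopologicalSpace (ExtendedHalfPlane Γ) where
  IsOpen U := IsOpen (pt ⁻¹' U) ∧ ∀ c hc, cusp c hc ∈ U → ∀ g : SL(2, ℝ),
    (g : GL (Fin 2) ℝ) • (OnePoint.infty : OnePoint ℝ) = c →
      ∃ A : ℝ, ∀ τ : UpperHalfPlane, A < τ.im → pt (g • τ) ∈ U
  isOpen_univ := ⟨isOpen_univ, fun _ _ _ _ _ => ⟨0, fun _ _ => trivial⟩⟩
  isOpen_inter U V hU hV := by
    refine ⟨hU.1.inter hV.1, fun c hc hcU g hg => ?_⟩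
    obtain ⟨A, hA⟩ := hU.2 c hc hcU.1 g hg
    obtain ⟨B, hB⟩ := hV.2 c hc hcU.2 g hg
    exact ⟨max A B, fun τ hτ => ⟨hA τ ((le_max_left _ _).trans_lt hτ),
      hB τ ((le_max_right _ _).trans_lt hτ)⟩⟩
  isOpen_sUnion S hS := by
    refine ⟨?_, fun c hc hcU g hg => ?_⟩
    · rw [Set.preimage_sUnion]
      exact isOpen_biUnion fun U hU => (hS U hU).1
    · obtain ⟨U, hU, hcU⟩ := hcU
      obtain ⟨A, hA⟩ := (hS U hU).2 c hc hcU g hg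
      exact ⟨A, fun τ hτ => ⟨U, hU, hA τ hτ⟩⟩

theorem isOpen_def {U : Set (ExtendedHalfPlane Γ)} : IsOpen U ↔
    IsOpen (pt ⁻¹' U) ∧ ∀ c hc, cusp c hc ∈ U → ∀ g : SL(2, ℝ),
      (g : GL (Fin 2) ℝ) • (OnePoint.infty : OnePoint ℝ) = c →
        ∃ A : ℝ, ∀ τ : UpperHalfPlane, A < τ.im → pt (g • τ) ∈ U := Iff.rfl

theorem continuous_pt : Continuous (pt : UpperHalfPlane → ExtendedHalfPlane Γ) :=
  ⟨fun _ hU => (isOpen_def.1 hU).1⟩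

theorem isCusp_smul {g : SL(2, ℝ)} (hg : g ∈ Norm Γ) {c : OnePoint ℝ}
    (hc : IsCusp c (Γ.map toGL)) : IsCusp ((g : GL (Fin 2) ℝ) • c) (Γ.map toGL) := by
  obtain ⟨x, ⟨γ, hγ, rfl⟩, hx, hxc⟩ := hc
  refine ⟨toGL (g * γ * g⁻¹), ⟨_, (hg γ).1 hγ, rfl⟩, ?_, ?_⟩
  · rw [map_mul, map_mul, map_inv]
    simpa using hx
  · rw [map_mul, map_mul, map_inv, mul_smul, mul_smul, inv_smul_smul, hxc]

/-- `SL₂(ℝ)` acts by Möbius transformations; the normalizer of `Γ` permutes its cusps. -/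
instance : MulAction (Norm Γ) (ExtendedHalfPlane Γ) where
  smul g x := match x with
    | pt τ => pt ((g : SL(2, ℝ)) • τ)
    | cusp c hc => cusp (((g : SL(2, ℝ)) : GL (Fin 2) ℝ) • c) (isCusp_smul g.2 hc)
  one_smul x := by
    cases x with
    | pt τ => exact congrArg pt (one_smul SL(2, ℝ) τ)
    | cusp c hc =>
      change cusp _ _ = cusp _ _
      congr 1
      simp
  mul_smul g h x := by
    cases x with
    | pt τ => exact congrArg pt (mul_smul (g : SL(2, ℝ)) (h : SL(2, ℝ)) τ)
    | cusp c hc =>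
      change cusp _ _ = cusp _ _
      congr 1
      simp [mul_smul]

theorem smul_pt (g : Norm Γ) (τ : UpperHalfPlane) :
    g • (pt τ : ExtendedHalfPlane Γ) = pt ((g : SL(2, ℝ)) • τ) := rfl

theorem smul_cusp (g : Norm Γ) (c : OnePoint ℝ) (hc : IsCusp c (Γ.map toGL)) :
    g • (cusp c hc : ExtendedHalfPlane Γ) =
      cusp (((g : SL(2, ℝ)) : GL (Fin 2) ℝ) • c) (isCusp_smul g.2 hc) := rfl

theorem continuous_SL_smul (g : SL(2, ℝ)) : Continuous fun τ : UpperHalfPlane => g • τ :=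
  continuous_const_smul (g : GL (Fin 2) ℝ)

instance : ContinuousConstSMul (Norm Γ) (ExtendedHalfPlane Γ) where
  continuous_const_smul g := by
    refine ⟨fun U hU => ?_⟩
    rw [isOpen_def] at hU ⊢
    refine ⟨hU.1.preimage (continuous_SL_smul (g : SL(2, ℝ))), fun c hc hcU k hk => ?_⟩
    obtain ⟨A, hA⟩ := hU.2 _ (isCusp_smul g.2 hc) hcU ((g : SL(2, ℝ)) * k)
      (by rw [map_mul, mul_smul, hk])
    refine ⟨A, fun τ hτ => ?_⟩
    have := hA τ hτ
    rwa [mul_smul] at this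

end ExtendedHalfPlane

/-! ### The modular curve as a Riemann surface -/

section Curve

variable (Γ : Subgroup SL(2, ℝ))

/-- `Γ` as a subgroup of its normalizer. -/
abbrev inNorm : Subgroup (Norm Γ) := Γ.subgroupOf (Norm Γ)

/-- The complex points of the modular curve: the orbit space of the extended upper half plane
under `Γ`, with the quotient topology. -/
abbrev Curve : Type := MulAction.orbitRel.Quotient (inNorm Γ) (ExtendedHalfPlane Γ)

variable {Γ}

/-- The quotient map. -/
def toCurve (x : ExtendedHalfPlane Γ) : Curve Γ := Quotient.mk _ x

/-- The quotient map on the upper half plane. -/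
def proj (τ : UpperHalfPlane) : Curve Γ := toCurve (ExtendedHalfPlane.pt τ)

theorem continuous_proj : Continuous (proj : UpperHalfPlane → Curve Γ) :=
  continuous_quot_mk.comp ExtendedHalfPlane.continuous_pt

/-- The complex structure of the modular curve, given by its sheaf of holomorphic functions:
a function on an open set `U` is holomorphic if it is continuous on `U` and its pull-back to the
upper half plane is holomorphic. (At an elliptic point or a cusp this is holomorphy in the usual
local parameter, by the removable singularity theorem.) -/
def IsHolomorphicOn (f : Curve Γ → ℂ) (U : Set (Curve Γ)) : Prop :=
  ContinuousOn f U ∧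
    MDifferentiableOn 𝓘(ℂ) 𝓘(ℂ) (fun τ : UpperHalfPlane => f (proj τ)) (proj ⁻¹' U)

variable (Γ)

/-- The automorphism group of the modular curve: the homeomorphisms `φ` such that a function is
holomorphic on an open set `U` if and only if its pull-back is holomorphic on `φ⁻¹(U)`. -/
def Aut : Subgroup (Curve Γ ≃ₜ Curve Γ) where
  carrier := {φ | ∀ U : Set (Curve Γ), IsOpen U → ∀ f : Curve Γ → ℂ,
    IsHolomorphicOn f U ↔ IsHolomorphicOn (f ∘ φ) (φ ⁻¹' U)}
  one_mem' := fun _ _ _ => Iff.rfl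
  mul_mem' := by
    intro φ ψ hφ hψ U hU f
    exact (hφ U hU f).trans (hψ _ (hU.preimage φ.continuous) _)
  inv_mem' := by
    intro φ hφ U hU f
    have h := hφ (φ.symm ⁻¹' U) (hU.preimage φ.symm.continuous) (f ∘ φ.symm)
    have e1 : (f ∘ φ.symm) ∘ φ = f := by ext x; simp
    have e2 : φ ⁻¹' (φ.symm ⁻¹' U) = U := by ext x; simp
    rw [e1, e2] at h
    exact h.symm

/-- The genus of the modular curve: half the first Betti number of its space of complex points. -/
def genus : ℕ :=
  Module.finrank ℚ (((AlgebraicTopology.singularHomologyFunctor (ModuleCat.{0} ℚ) 1).obj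
    (ModuleCat.of ℚ ℚ)).obj (TopCat.of (Curve Γ))) / 2

/-! ### Modular automorphisms -/

variable {Γ}

/-- The map of the curve induced by an element of the normalizer. -/
def inducedFun (g : Norm Γ) : Curve Γ → Curve Γ :=
  Quotient.map (fun x => g • x) (by
    rintro x y ⟨⟨γ, hγ⟩, rfl⟩
    refine ⟨⟨g * γ * g⁻¹, ?_⟩, ?_⟩
    · exact (g.2 _).1 hγ
    · change (g * γ * g⁻¹) • g • y = g • γ • y
      rw [mul_smul, mul_smul, inv_smul_smul])

theorem inducedFun_toCurve (g : Norm Γ) (x : ExtendedHalfPlane Γ) :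
    inducedFun g (toCurve x) = toCurve (g • x) := rfl

theorem inducedFun_mul (g h : Norm Γ) (x : Curve Γ) :
    inducedFun (g * h) x = inducedFun g (inducedFun h x) := by
  induction x using Quotient.inductionOn with
  | h x => exact congrArg toCurve (mul_smul g h x)

theorem inducedFun_one (x : Curve Γ) : inducedFun (1 : Norm Γ) x = x := by
  induction x using Quotient.inductionOn with
  | h x => exact congrArg toCurve (one_smul _ x)

theorem continuous_inducedFun (g : Norm Γ) : Continuous (inducedFun g) :=
  Continuous.quotient_map' (continuous_const_smul g) _

/-- The homeomorphism of the curve induced by an element of the normalizer. -/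
def inducedHomeo (g : Norm Γ) : Curve Γ ≃ₜ Curve Γ where
  toFun := inducedFun g
  invFun := inducedFun g⁻¹
  left_inv x := by rw [← inducedFun_mul, inv_mul_cancel, inducedFun_one]
  right_inv x := by rw [← inducedFun_mul, mul_inv_cancel, inducedFun_one]
  continuous_toFun := continuous_inducedFun g
  continuous_invFun := continuous_inducedFun g⁻¹

theorem inducedFun_proj (g : Norm Γ) (τ : UpperHalfPlane) :
    inducedFun g (proj τ) = proj ((g : SL(2, ℝ)) • τ) := rfl

theorem IsHolomorphicOn.comp_inducedFun {f : Curve Γ → ℂ} {U : Set (Curve Γ)}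
    (hf : IsHolomorphicOn f U) (g : Norm Γ) :
    IsHolomorphicOn (f ∘ inducedFun g) (inducedFun g ⁻¹' U) := by
  refine ⟨hf.1.comp (continuous_inducedFun g).continuousOn (fun _ h => h), ?_⟩
  have h : MDifferentiable 𝓘(ℂ) 𝓘(ℂ) (fun τ : UpperHalfPlane => (g : SL(2, ℝ)) • τ) :=
    UpperHalfPlane.mdifferentiable_smul (g := ((g : SL(2, ℝ)) : GL (Fin 2) ℝ)) (by simp)
  exact hf.2.comp h.mdifferentiableOn (fun _ h => h)

/-- The homomorphism from the normalizer of `Γ` to the automorphism group of the curve. -/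
def inducedAut : Norm Γ →* Aut Γ where
  toFun g := ⟨inducedHomeo g, fun U _ f => by
    refine ⟨fun h => h.comp_inducedFun g, fun h => ?_⟩
    have h' := h.comp_inducedFun g⁻¹
    have e (x : Curve Γ) : inducedHomeo g (inducedFun g⁻¹ x) = x :=
      (inducedHomeo g).right_inv x
    have e1 : (f ∘ inducedHomeo g) ∘ inducedFun g⁻¹ = f := by ext x; simp [e]
    have e2 : inducedFun g⁻¹ ⁻¹' (inducedHomeo g ⁻¹' U) = U := by ext x; simp [e]
    rwa [e1, e2] at h'⟩
  map_one' := Subtype.ext (Homeomorph.ext inducedFun_one)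
  map_mul' g h := Subtype.ext (Homeomorph.ext (inducedFun_mul g h))

instance : (inNorm Γ).Normal := Subgroup.normal_in_normalizer

variable (Γ)

/-- The group of modular automorphisms, `B = Norm(Γ)/Γ`. -/
abbrev B : Type := Norm Γ ⧸ inNorm Γ

/-- The natural map from `B` to the automorphism group of the curve. -/
def BtoAut : B Γ →* Aut Γ :=
  QuotientGroup.lift (inNorm Γ) inducedAut (by
    intro γ hγ
    refine Subtype.ext (Homeomorph.ext fun x => ?_)
    induction x using Quotient.inductionOn with
    | h x => exact Quotient.sound ⟨⟨γ, hγ⟩, rfl⟩)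

end Curve

end ModularCurve

end

/-!
The argument is elementary and uniform in `p`. Write `Γ = Γ_ns(p)` and let `K ⊂ M₂(𝔽_p)` be the
field with `C = Kˣ`.

*The normalizer is integral.* Let `g ∈ SL₂(ℝ)` normalize `Γ`. For `v ∈ ℤ²` the unipotent matrix
`1 + p v vᵗ J`, with `J = [[0, 1], [-1, 0]]`, lies in `Γ(p) ⊂ Γ`, so its conjugate
`1 + p (g v)(g v)ᵗ J` lies in `Γ`. The field `K` contains no unipotent element other than `1`, hence
the conjugate is congruent to `1` modulo `p`, and the matrix `(g v)(g v)ᵗ` is integral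
(`mul_mem_intRange_of_mem_Norm`). Applied to `g`, `g⁻¹` and a few vectors `v` this shows that any two
entries of `g` have an integral product. As `det g = 1`, the `ℤ`-span `L` of the entries satisfies
`L² = ℤ`, and this forces `g` to be integral (`mem_range_intToReal`).

*The normalizer modulo `p`.* The field `K` contains a matrix of determinant `1` which is not scalar
(`exists_mem_det_eq_one`). It lifts to `Γ` and generates `K` over `𝔽_p`, so an integral matrix
normalizing `Γ` normalizes `C` modulo `p` (`Norm_levelGroup_eq`).

*The modular involution.* Conjugation by an element of `N(C)` is an automorphism of `K` over `𝔽_p`,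
trivial only on the centralizer `K` of a non-scalar element; hence `N(C) / C` has at most two
elements. The matrices which induce the non-trivial automorphism, together with `0`, form a plane on
which `det` is a quadratic form representing `1` (`exists_det_eq_one_mul_eq_adjugate_mul`), which
provides elements of `N(C) \ C` in `SL₂(𝔽_p)`, and `SL₂(ℤ) → SL₂(𝔽_p)` is onto
(`exists_reduction_eq`).

*Faithfulness.* The point `τ = ⁴√2 i` has stabilizer `±1` in `SL₂(ℤ)`. If an integral matrix `g` acts
trivially on the curve, then `g τ = γ τ` for some `γ ∈ Γ`, so that `g = ±γ` lies in `Γ`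
(`BtoAut_injective`).
-/

namespace ModularCurve

/-! ### Integrality of real matrices -/

theorem exists_coe_eq_of_det_eq_one {R : Type*} [CommRing R] {A : Matrix (Fin 2) (Fin 2) R}
    (hA : A.det = 1) : ∃ g : SL(2, R), (g : Matrix (Fin 2) (Fin 2) R) = A :=
  ⟨⟨A, hA⟩, rfl⟩

/-- Let `L` be the `ℤ`-span of `a, b, c, d`. The ideal `x L` of `ℤ` has a generator `y = x l` with
`l ∈ L`. Then `x²` divides `y² = x² l²`, since `l²` is an integer, and `y²` divides
`x² = (x a) (x d) - (x b) (x c)`. So `x = ±y`. -/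
theorem mem_intRange_of_mul_mem {a b c d x : ℝ} (hdet : a * d - b * c = 1)
    (hx : x * x ∈ (Int.castRingHom ℝ).range)
    (ha : x * a ∈ (Int.castRingHom ℝ).range) (hb : x * b ∈ (Int.castRingHom ℝ).range)
    (hc : x * c ∈ (Int.castRingHom ℝ).range) (hd : x * d ∈ (Int.castRingHom ℝ).range)
    (hsq : ∀ k l m n : ℤ, (k * a + l * b + m * c + n * d) * (k * a + l * b + m * c + n * d) ∈
      (Int.castRingHom ℝ).range) :
    x ∈ (Int.castRingHom ℝ).range := by
  obtain ⟨X, hX⟩ := hx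
  obtain ⟨A, hA⟩ := ha
  obtain ⟨B, hB⟩ := hb
  obtain ⟨C, hC⟩ := hc
  obtain ⟨D, hD⟩ := hd
  simp only [eq_intCast] at hX hA hB hC hD
  obtain ⟨y, hy⟩ := IsPrincipalIdealRing.principal (Ideal.span ({A, B, C, D} : Set ℤ))
  have hdvd : ∀ z ∈ ({A, B, C, D} : Set ℤ), y ∣ z := fun z hz =>
    by
    have := Ideal.subset_span (α := ℤ) hz
    rw [hy] at this
    exact Ideal.mem_span_singleton.1 this
  have hymem : y ∈ Ideal.span ({A, B, C, D} : Set ℤ) := by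
    rw [hy]; exact Ideal.mem_span_singleton_self y
  simp only [Ideal.mem_span_insert, Ideal.mem_span_singleton'] at hymem
  obtain ⟨k, _, ⟨l, _, ⟨m, _, ⟨n, rfl⟩, rfl⟩, rfl⟩, hyk⟩ := hymem
  have hyR : (y : ℝ) = x * (k * a + l * b + m * c + n * d) := by
    rw [hyk]; push_cast; rw [hA, hB, hC, hD]; ring
  obtain ⟨N, hN⟩ := hsq k l m n
  simp only [eq_intCast] at hN
  have h1 : X ∣ y * y := ⟨N, by
    have : (y * y : ℝ) = X * N := by rw [hN, hX, hyR]; ring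
    exact_mod_cast this⟩
  have h2 : y * y ∣ X := by
    have e : X = A * D - B * C := by
      have : (X : ℝ) = A * D - B * C := by
        rw [hA, hB, hC, hD, hX]; linear_combination (-x * x) * hdet
      exact_mod_cast this
    rw [e]
    exact dvd_sub (mul_dvd_mul (hdvd A (by simp)) (hdvd D (by simp)))
      (mul_dvd_mul (hdvd B (by simp)) (hdvd C (by simp)))
  have h3 : X = y * y := Int.dvd_antisymm
    (by have : (0 : ℝ) ≤ X := hX ▸ mul_self_nonneg x
        exact_mod_cast this) (mul_self_nonneg y) h1 h2
  have h4 : x * x = y * y := by rw [← hX, h3]; push_cast; rfl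
  rcases mul_self_eq_mul_self_iff.1 h4 with h | h
  · exact ⟨y, by simp [h]⟩
  · exact ⟨-y, by simp [h]⟩

/-- A real number is an integer if its square and its double are. -/
theorem mem_intRange_of_two_mul {x : ℝ} (h2 : 2 * x ∈ (Int.castRingHom ℝ).range)
    (hsq : x * x ∈ (Int.castRingHom ℝ).range) : x ∈ (Int.castRingHom ℝ).range := by
  obtain ⟨m, hm⟩ := h2
  obtain ⟨n, hn⟩ := hsq
  simp only [eq_intCast] at hm hn
  have h : m * m = 4 * n := by
    have : (m * m : ℝ) = 4 * n := by rw [hm, hn]; ring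
    exact_mod_cast this
  have he : Even m := by
    have : Even (m * m) := ⟨2 * n, by rw [h]; ring⟩
    simpa [Int.even_mul] using this
  obtain ⟨k, rfl⟩ := he
  refine ⟨k, ?_⟩
  push_cast at hm
  simp only [eq_intCast]
  linarith

/-- A matrix of determinant `1` whose entries have integral pairwise products is integral. -/
theorem mem_range_intToReal {g : SL(2, ℝ)}
    (h : ∀ i j k l, g i j * g k l ∈ (Int.castRingHom ℝ).range) : g ∈ intToReal.range := by
  have hdet : g 0 0 * g 1 1 - g 0 1 * g 1 0 = 1 := by
    rw [← Matrix.det_fin_two]; exact g.2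
  have key : ∀ i j, g i j ∈ (Int.castRingHom ℝ).range := fun i j =>
    mem_intRange_of_mul_mem hdet (h _ _ _ _) (h _ _ _ _) (h _ _ _ _) (h _ _ _ _) (h _ _ _ _) (by
      intro k l m n
      have e : (k * g 0 0 + l * g 0 1 + m * g 1 0 + n * g 1 1) *
          (k * g 0 0 + l * g 0 1 + m * g 1 0 + n * g 1 1) =
          ((k * k : ℤ) : ℝ) * (g 0 0 * g 0 0) + ((l * l : ℤ) : ℝ) * (g 0 1 * g 0 1) +
          ((m * m : ℤ) : ℝ) * (g 1 0 * g 1 0) + ((n * n : ℤ) : ℝ) * (g 1 1 * g 1 1) +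
          ((2 * k * l : ℤ) : ℝ) * (g 0 0 * g 0 1) + ((2 * k * m : ℤ) : ℝ) * (g 0 0 * g 1 0) +
          ((2 * k * n : ℤ) : ℝ) * (g 0 0 * g 1 1) + ((2 * l * m : ℤ) : ℝ) * (g 0 1 * g 1 0) +
          ((2 * l * n : ℤ) : ℝ) * (g 0 1 * g 1 1) + ((2 * m * n : ℤ) : ℝ) * (g 1 0 * g 1 1) := by
        push_cast; ring
      have hi (z : ℤ) : (z : ℝ) ∈ (Int.castRingHom ℝ).range := ⟨z, rfl⟩
      rw [e]
      repeat' apply add_mem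
      all_goals exact mul_mem (hi _) (h _ _ _ _))
  choose γ hγ using key
  simp only [eq_intCast] at hγ
  obtain ⟨δ, hδ⟩ := exists_coe_eq_of_det_eq_one (A := Matrix.of γ) (by
    rw [Matrix.det_fin_two]
    have : (γ 0 0 * γ 1 1 - γ 0 1 * γ 1 0 : ℝ) = 1 := by simp only [hγ]; exact hdet
    simp only [Matrix.of_apply]
    exact_mod_cast this)
  refine ⟨δ, ?_⟩
  ext i j
  simp [intToReal, hδ, hγ]

/-! ### Reduction of `SL₂(ℤ)` modulo a prime -/

theorem intToReal_injective : Function.Injective intToReal := by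
  intro γ δ h
  ext i j
  have := congrArg (fun g : SL(2, ℝ) => g i j) h
  simpa [intToReal] using this

theorem intToReal_apply (γ : SL(2, ℤ)) (i j : Fin 2) : intToReal γ i j = (γ i j : ℝ) := by
  simp [intToReal]

theorem reduction_apply {N : ℕ} (γ : SL(2, ℤ)) (i j : Fin 2) :
    (reduction N γ : Matrix (Fin 2) (Fin 2) (ZMod N)) i j = (γ i j : ZMod N) := by
  simp [reduction]

theorem det_reduction {N : ℕ} (γ : SL(2, ℤ)) :
    (reduction N γ : Matrix (Fin 2) (Fin 2) (ZMod N)).det = 1 :=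
  (SpecialLinearGroup.map (Int.castRingHom (ZMod N)) γ).2

theorem intToReal_mem_levelGroup {N : ℕ} {H : Subgroup (GL (Fin 2) (ZMod N))} {γ : SL(2, ℤ)} :
    intToReal γ ∈ levelGroup H ↔ reduction N γ ∈ H := by
  rw [levelGroup, Subgroup.mem_map_iff_mem intToReal_injective, Subgroup.mem_comap]

/-- A matrix `[[a, b], [c, d]]` of determinant `1` with `c ≠ 0` is the product of the unipotent
matrices `[[1, (a - 1) / c], [0, 1]]`, `[[1, 0], [c, 1]]` and `[[1, (d - 1) / c], [0, 1]]`, each of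
which lifts to `SL₂(ℤ)`. -/
theorem exists_reduction_eq_of_ne_zero {p : ℕ} [Fact p.Prime]
    {M : Matrix (Fin 2) (Fin 2) (ZMod p)} (hM : M.det = 1) (hc : M 1 0 ≠ 0) :
    ∃ γ : SL(2, ℤ), (reduction p γ : Matrix (Fin 2) (Fin 2) (ZMod p)) = M := by
  obtain ⟨x, hx⟩ := ZMod.intCast_surjective ((M 0 0 - 1) / M 1 0)
  obtain ⟨y, hy⟩ := ZMod.intCast_surjective ((M 1 1 - 1) / M 1 0)
  obtain ⟨c, hc'⟩ := ZMod.intCast_surjective (M 1 0)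
  obtain ⟨γ, hγ⟩ := exists_coe_eq_of_det_eq_one
    (A := !![1 + x * c, x + (1 + x * c) * y; c, 1 + c * y]) (by rw [Matrix.det_fin_two_of]; ring)
  refine ⟨γ, ?_⟩
  rw [Matrix.det_fin_two] at hM
  ext i j
  rw [reduction_apply]
  fin_cases i <;> fin_cases j <;> simp [hγ, hx, hy, hc']
  · field_simp; ring
  · field_simp; linear_combination hM
  · field_simp; ring

theorem exists_reduction_eq {p : ℕ} [Fact p.Prime] {M : Matrix (Fin 2) (Fin 2) (ZMod p)}
    (hM : M.det = 1) : ∃ γ : SL(2, ℤ), (reduction p γ : Matrix (Fin 2) (Fin 2) (ZMod p)) = M := by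
  by_cases hc : M 1 0 = 0
  · have h1 : (!![1, 0; 1, 1] * M).det = 1 := by rw [Matrix.det_mul, hM]; simp
    obtain ⟨γ, hγ⟩ := exists_reduction_eq_of_ne_zero h1 (by
      intro h
      have h0 : M 0 0 = 0 := by simpa [Matrix.mul_apply, Fin.sum_univ_two, hc] using h
      rw [Matrix.det_fin_two] at hM
      simp [hc, h0] at hM)
    obtain ⟨δ, hδ⟩ := exists_coe_eq_of_det_eq_one (A := (!![1, 0; -1, 1] : Matrix _ _ ℤ))
      (by simp)
    refine ⟨δ * γ, ?_⟩
    rw [map_mul, Units.val_mul, hγ, ← Matrix.mul_assoc]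
    convert Matrix.one_mul M
    ext i j
    fin_cases i <;> fin_cases j <;>
      simp [Matrix.mul_apply, Fin.sum_univ_two, reduction_apply, hδ]
  · exact exists_reduction_eq_of_ne_zero hM hc

/-! ### Quadratic fields of `2 × 2` matrices -/

section QuadraticField

variable {F : Type*} [Field F] {K : Subalgebra F (Matrix (Fin 2) (Fin 2) F)}

theorem mul_comm_of_isField (hK : IsField K) {x y : Matrix (Fin 2) (Fin 2) F} (hx : x ∈ K)
    (hy : y ∈ K) : x * y = y * x :=
  congrArg Subtype.val (hK.mul_comm ⟨x, hx⟩ ⟨y, hy⟩)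

theorem eq_zero_or_eq_zero_of_isField (hK : IsField K) {x y : Matrix (Fin 2) (Fin 2) F}
    (hx : x ∈ K) (hy : y ∈ K) (h : x * y = 0) : x = 0 ∨ y = 0 := by
  let := hK.toField
  have : (⟨x, hx⟩ : K) * ⟨y, hy⟩ = 0 := Subtype.ext h
  rcases mul_eq_zero.1 this with h | h
  · exact Or.inl (congrArg Subtype.val h)
  · exact Or.inr (congrArg Subtype.val h)

/-- An upper triangular matrix in a field of matrices is scalar. The condition `y 1 0 ≠ 0` therefore
singles out the non-scalar elements of `K`. -/
theorem eq_smul_one_of_apply_one_zero (hK : IsField K) {y : Matrix (Fin 2) (Fin 2) F}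
    (hy : y ∈ K) (h : y 1 0 = 0) : y = y 0 0 • (1 : Matrix (Fin 2) (Fin 2) F) := by
  have hs (t : F) : y - t • 1 ∈ K := sub_mem hy (K.smul_mem K.one_mem t)
  have h0 : (y - y 0 0 • 1) * (y - y 1 1 • 1) = 0 := by
    ext i j
    fin_cases i <;> fin_cases j <;> simp [Matrix.mul_apply, Fin.sum_univ_two, h]
  rcases eq_zero_or_eq_zero_of_isField hK (hs _) (hs _) h0 with h1 | h1
  · exact sub_eq_zero.1 h1
  · have h2 := congrFun (congrFun h1 0) 0
    simp only [Matrix.sub_apply, Matrix.smul_apply, Matrix.one_apply_eq, smul_eq_mul, mul_one,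
      Matrix.zero_apply, sub_eq_zero] at h2
    rw [h2]
    exact sub_eq_zero.1 h1

/-- The centralizer of a non-scalar matrix `y` is spanned by `y` and `1`. -/
theorem exists_eq_smul_add_smul_of_commute {y g : Matrix (Fin 2) (Fin 2) F} (hy : y 1 0 ≠ 0)
    (h : g * y = y * g) : ∃ s t : F, g = s • y + t • (1 : Matrix (Fin 2) (Fin 2) F) := by
  refine ⟨g 1 0 / y 1 0, g 1 1 - g 1 0 / y 1 0 * y 1 1, ?_⟩
  have h0 := congrFun (congrFun h 0) 0
  have h1 := congrFun (congrFun h 1) 0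
  simp only [Matrix.mul_apply, Fin.sum_univ_two] at h0 h1
  ext i j
  fin_cases i <;> fin_cases j <;> simp
  · field_simp; linear_combination -h1
  · field_simp; linear_combination h0
  · field_simp

theorem mem_of_commute {y g : Matrix (Fin 2) (Fin 2) F} (hyK : y ∈ K) (hy : y 1 0 ≠ 0)
    (h : g * y = y * g) : g ∈ K := by
  obtain ⟨s, t, rfl⟩ := exists_eq_smul_add_smul_of_commute hy h
  exact add_mem (K.smul_mem hyK s) (K.smul_mem K.one_mem t)

theorem adjugate_eq (y : Matrix (Fin 2) (Fin 2) F) : y.adjugate = y.trace • 1 - y := by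
  ext i j
  fin_cases i <;> fin_cases j <;> simp [Matrix.adjugate_fin_two, Matrix.trace_fin_two]

theorem adjugate_mem {y : Matrix (Fin 2) (Fin 2) F} (hy : y ∈ K) : y.adjugate ∈ K := by
  rw [adjugate_eq]
  exact sub_mem (K.smul_mem K.one_mem _) hy

/-- A quadratic polynomial over the field `K` with root `y` has no roots besides `y` and its
conjugate, which is the adjugate of `y`. -/
theorem eq_or_eq_adjugate (hK : IsField K) {y z : Matrix (Fin 2) (Fin 2) F} (hy : y ∈ K)
    (hz : z ∈ K) (htr : z.trace = y.trace) (hdet : z.det = y.det) : z = y ∨ z = y.adjugate := by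
  have hcomm := mul_comm_of_isField hK hy hz
  have hq (x : Matrix (Fin 2) (Fin 2) F) : x * x = x.trace • x - x.det • 1 := by
    ext i j
    fin_cases i <;> fin_cases j <;>
      simp [Matrix.mul_apply, Fin.sum_univ_two, Matrix.trace_fin_two, Matrix.det_fin_two] <;> ring
  have h0 : (z - y) * (z - y.adjugate) = 0 := by
    rw [adjugate_eq]
    have e : (z - y) * (z - (y.trace • 1 - y)) =
        z * z - y * y - y.trace • z + y.trace • y + (z * y - y * z) := by
      simp only [mul_sub, sub_mul, mul_smul_comm, mul_one, smul_sub]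
      abel
    rw [e, hq z, hq y, htr, hdet, hcomm]
    abel
  rcases eq_zero_or_eq_zero_of_isField hK (sub_mem hz hy) (sub_mem hz (adjugate_mem hy)) h0
    with h | h
  · exact Or.inl (sub_eq_zero.1 h)
  · exact Or.inr (sub_eq_zero.1 h)

/-- A unipotent element of a field of matrices is trivial. -/
theorem eq_one_of_trace_eq_two (hK : IsField K) {u : Matrix (Fin 2) (Fin 2) F} (hu : u ∈ K)
    (hdet : u.det = 1) (htr : u.trace = 2) : u = 1 := by
  rcases eq_or_eq_adjugate hK (one_mem K) hu (by simpa using htr) (by simpa using hdet) with h | h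
  · exact h
  · simpa using h

theorem conj_mem_of_conj_mem (hK : IsField K) (g : GL (Fin 2) F) {y : Matrix (Fin 2) (Fin 2) F}
    (hyK : y ∈ K) (hy : y 1 0 ≠ 0)
    (h : (g : Matrix (Fin 2) (Fin 2) F) * y * (g⁻¹ : GL (Fin 2) F) ∈ K)
    {k : Matrix (Fin 2) (Fin 2) F} (hk : k ∈ K) :
    (g : Matrix (Fin 2) (Fin 2) F) * k * (g⁻¹ : GL (Fin 2) F) ∈ K := by
  obtain ⟨s, t, rfl⟩ := exists_eq_smul_add_smul_of_commute hy (mul_comm_of_isField hK hk hyK)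
  have e : (g : Matrix (Fin 2) (Fin 2) F) * (s • y + t • 1) * (g⁻¹ : GL (Fin 2) F) =
      s • ((g : Matrix (Fin 2) (Fin 2) F) * y * (g⁻¹ : GL (Fin 2) F)) + t • 1 := by
    rw [mul_add, add_mul, mul_smul_comm, smul_mul_assoc, mul_smul_comm, smul_mul_assoc, mul_one,
      Units.mul_inv]
  rw [e]
  exact add_mem (K.smul_mem h s) (K.smul_mem K.one_mem t)

/-- An element of `GL₂` which conjugates one non-scalar element of `K` into `K` normalizes `Kˣ`. -/
theorem mem_normalizer_of_conj_mem (hK : IsField K) {C : Subgroup (GL (Fin 2) F)}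
    (hC : ∀ g : GL (Fin 2) F, g ∈ C ↔ (g : Matrix (Fin 2) (Fin 2) F) ∈ K)
    (g : GL (Fin 2) F) {y : Matrix (Fin 2) (Fin 2) F} (hyK : y ∈ K) (hy : y 1 0 ≠ 0)
    (h : (g : Matrix (Fin 2) (Fin 2) F) * y * (g⁻¹ : GL (Fin 2) F) ∈ K) :
    g ∈ Subgroup.normalizer (C : Set (GL (Fin 2) F)) := by
  set z := (g : Matrix (Fin 2) (Fin 2) F) * y * (g⁻¹ : GL (Fin 2) F) with hz
  have hzy : ((g⁻¹ : GL (Fin 2) F) : Matrix (Fin 2) (Fin 2) F) * z * ((g⁻¹)⁻¹ : GL (Fin 2) F) =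
      y := by
    rw [hz, inv_inv]
    simp only [mul_assoc, Units.inv_mul, mul_one, Units.inv_mul_cancel_left]
  have hz0 : z 1 0 ≠ 0 := by
    intro h0
    have h1 := eq_smul_one_of_apply_one_zero hK h h0
    rw [h1, mul_smul_comm, mul_one, smul_mul_assoc, inv_inv, Units.inv_mul] at hzy
    exact hy (by simp [← hzy])
  rw [Subgroup.mem_normalizer_iff]
  intro k
  rw [hC, hC]
  refine ⟨fun hk => ?_, fun hk => ?_⟩
  · simpa using conj_mem_of_conj_mem hK g hyK hy h hk
  · have := conj_mem_of_conj_mem hK g⁻¹ h hz0 (hzy ▸ hyK) hk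
    rw [← Units.val_mul, ← Units.val_mul] at this
    simpa [mul_assoc] using this

end QuadraticField

/-! ### Non-split Cartan subgroups and `SL₂(𝔽_p)` -/

section FiniteField

variable {p : ℕ} [Fact p.Prime] {K : Subalgebra (ZMod p) (Matrix (Fin 2) (Fin 2) (ZMod p))}

theorem exists_mem_apply_one_zero_ne_zero (hK : IsField K) (hcard : Nat.card K = p ^ 2) :
    ∃ y ∈ K, y 1 0 ≠ 0 := by
  by_contra! h
  have hinj : Function.Injective fun y : K => (y : Matrix (Fin 2) (Fin 2) (ZMod p)) 0 0 := by
    intro x y hxy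
    apply Subtype.ext
    rw [eq_smul_one_of_apply_one_zero hK x.2 (h _ x.2),
      eq_smul_one_of_apply_one_zero hK y.2 (h _ y.2)]
    exact congrArg (fun t : ZMod p => t • (1 : Matrix (Fin 2) (Fin 2) (ZMod p))) hxy
  have hle := Nat.card_le_card_of_injective _ hinj
  rw [hcard, Nat.card_zmod] at hle
  have := (Fact.out : p.Prime).one_lt
  nlinarith

theorem eq_two_of_two_eq_zero (h : (2 : ZMod p) = 0) : p = 2 :=
  ((Nat.prime_dvd_prime_iff_eq Fact.out Nat.prime_two).1
    ((ZMod.natCast_eq_zero_iff 2 p).1 (by exact_mod_cast h)))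

/-- In characteristic `2` a matrix with trace `0` is a root of `X² + det = (X + det)²`, since every
element of `𝔽₂` is its own square. -/
theorem trace_ne_zero_of_two_eq_zero (hK : IsField K)
    {y : Matrix (Fin 2) (Fin 2) (ZMod p)} (hyK : y ∈ K) (hy : y 1 0 ≠ 0)
    (h2 : (2 : ZMod p) = 0) : y.trace ≠ 0 := by
  intro htr
  have hsq (s : ZMod p) : s * s = s := by
    obtain rfl := eq_two_of_two_eq_zero h2
    simpa [pow_two] using ZMod.pow_card s
  rcases eq_or_eq_adjugate hK hyK (K.smul_mem K.one_mem y.det) (by simp [h2, htr])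
    (by simp [pow_two, hsq]) with h | h
  · exact hy (by rw [← h]; simp)
  · have := congrFun (congrFun h 1) 0
    simp [Matrix.adjugate_fin_two] at this
    exact hy this

theorem ne_adjugate (hK : IsField K) {y : Matrix (Fin 2) (Fin 2) (ZMod p)} (hyK : y ∈ K)
    (hy : y 1 0 ≠ 0) : y ≠ y.adjugate := by
  intro h
  have h10 := congrFun (congrFun h 1) 0
  have h00 := congrFun (congrFun h 0) 0
  simp only [Matrix.adjugate_fin_two, Matrix.of_apply, Matrix.cons_val', Matrix.cons_val_zero,
    Matrix.cons_val_one, Matrix.cons_val_fin_one] at h10 h00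
  have h2 : (2 : ZMod p) = 0 := by
    have : 2 * y 1 0 = 0 := by linear_combination h10
    exact (mul_eq_zero.1 this).resolve_right hy
  apply trace_ne_zero_of_two_eq_zero hK hyK hy h2
  rw [Matrix.trace_fin_two]
  linear_combination -h00 + y 0 0 * h2

theorem det_ne_zero_of_mem (hK : IsField K) {y : Matrix (Fin 2) (Fin 2) (ZMod p)} (hyK : y ∈ K)
    (hy : y 1 0 ≠ 0) : y.det ≠ 0 := by
  intro h
  have h0 : y * y.adjugate = 0 := by rw [Matrix.mul_adjugate, h, zero_smul]
  rcases eq_zero_or_eq_zero_of_isField hK hyK (adjugate_mem hyK) h0 with h | h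
  · exact hy (by rw [h]; rfl)
  · have := congrFun (congrFun h 1) 0
    simp [Matrix.adjugate_fin_two] at this
    exact hy this

/-- The elements `y² / det y` have norm `1`; one of those attached to `y` and `y + 1` is
non-scalar, because `y²` is scalar only if `y` has trace `0`. -/
theorem exists_mem_det_eq_one (hK : IsField K) (hcard : Nat.card K = p ^ 2) :
    ∃ x ∈ K, x 1 0 ≠ 0 ∧ x.det = 1 := by
  have key : ∀ y ∈ K, y 1 0 ≠ 0 → y.trace ≠ 0 → ∃ x ∈ K, x 1 0 ≠ 0 ∧ x.det = 1 := by
    intro y hyK hy htr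
    have hd := det_ne_zero_of_mem hK hyK hy
    refine ⟨y.det⁻¹ • (y * y), K.smul_mem (mul_mem hyK hyK) _, ?_, ?_⟩
    · have e : (y * y) 1 0 = y 1 0 * y.trace := by
        simp only [Matrix.mul_apply, Fin.sum_univ_two, Matrix.trace_fin_two]; ring
      rw [Matrix.smul_apply, e]
      exact smul_ne_zero (inv_ne_zero hd) (mul_ne_zero hy htr)
    · rw [Matrix.det_smul, Matrix.det_mul, Fintype.card_fin]
      field_simp
  obtain ⟨y, hyK, hy⟩ := exists_mem_apply_one_zero_ne_zero hK hcard
  by_cases htr : y.trace = 0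
  · refine key (y + 1) (add_mem hyK K.one_mem) (by simpa using hy) fun h => ?_
    rw [Matrix.trace_add, htr] at h
    exact trace_ne_zero_of_two_eq_zero hK hyK hy (by simpa using h) htr
  · exact key y hyK hy htr

/-- The matrices `g` with `g y = ȳ g`, where `ȳ` is the conjugate (adjugate) of `y`, form a plane on
which the determinant is a binary quadratic form; over a finite field it represents `1`. -/
theorem exists_det_eq_one_mul_eq_adjugate_mul (hK : IsField K)
    {y : Matrix (Fin 2) (Fin 2) (ZMod p)} (hyK : y ∈ K) (hy : y 1 0 ≠ 0) :
    ∃ g : Matrix (Fin 2) (Fin 2) (ZMod p), g.det = 1 ∧ g * y = y.adjugate * g := by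
  -- the plane, in the coordinates `u = g 0 0` and `t = g 1 0 / y 1 0`
  suffices h : ∃ u t : ZMod p,
      u * u + (y 1 1 - y 0 0) * u * t - y 0 1 * y 1 0 * (t * t) = -1 by
    obtain ⟨u, t, h⟩ := h
    refine ⟨!![u, ((y 1 1 - y 0 0) * u - y 0 1 * y 1 0 * t) / y 1 0; y 1 0 * t, -u], ?_, ?_⟩
    · rw [Matrix.det_fin_two_of]
      field_simp
      linear_combination -h
    · ext i j
      fin_cases i <;> fin_cases j <;>
        simp [Matrix.mul_apply, Fin.sum_univ_two, Matrix.adjugate_fin_two] <;> field_simp <;> ring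
  by_cases h2 : (2 : ZMod p) = 0
  · exact ⟨1, 0, by linear_combination h2⟩
  · -- complete the square; the discriminant is non-zero since `y` has two distinct eigenvalues
    set D : ZMod p := ((y 1 1 - y 0 0) / 2) ^ 2 + y 0 1 * y 1 0 with hD
    have hD0 : D ≠ 0 := by
      intro h0
      rcases eq_or_eq_adjugate hK hyK (K.smul_mem K.one_mem (y.trace / 2))
        (by simp; field_simp) (by
          rw [hD] at h0
          simp only [Matrix.det_smul, Fintype.card_fin, Matrix.det_one, mul_one,
            Matrix.trace_fin_two, Matrix.det_fin_two]
          field_simp at h0 ⊢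
          linear_combination h0) with h | h
      · exact hy (by rw [← h]; simp)
      · have := congrFun (congrFun h 1) 0
        simp [Matrix.adjugate_fin_two] at this
        exact hy this
    have hodd : Fintype.card (ZMod p) % 2 = 1 := by
      rw [ZMod.card]
      rcases (Fact.out : p.Prime).eq_two_or_odd with h | h
      · exfalso; subst h; exact h2 (by exact_mod_cast ZMod.natCast_self 2)
      · exact h
    obtain ⟨X, t, hXt⟩ := FiniteField.exists_root_sum_quadratic
      (f := Polynomial.X ^ 2 + Polynomial.C 1) (g := Polynomial.C (-D) * Polynomial.X ^ 2)
      (Polynomial.degree_X_pow_add_C (by decide) (1 : ZMod p))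
      (Polynomial.degree_C_mul_X_pow 2 (neg_ne_zero.2 hD0)) hodd
    simp only [Polynomial.eval_add, Polynomial.eval_mul, Polynomial.eval_pow, Polynomial.eval_X,
      Polynomial.eval_C] at hXt
    refine ⟨X - (y 1 1 - y 0 0) / 2 * t, t, ?_⟩
    rw [hD] at hXt
    field_simp at hXt ⊢
    linear_combination hXt

end FiniteField

/-! ### The normalizer of `Γ_ns(p)` -/

section Normalizer

variable {p : ℕ} [Fact p.Prime] {C : Subgroup (GL (Fin 2) (ZMod p))}
  {K : Subalgebra (ZMod p) (Matrix (Fin 2) (Fin 2) (ZMod p))}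

/-- For `v = (m, n)` the matrix `1 + p v vᵗ J`, with `J = [[0, 1], [-1, 0]]`, is unipotent and lies
in `Γ(p)`. Its conjugate by `g` is `1 + p (g v)(g v)ᵗ J`, where `g v = (X, Y)`. As a unipotent
element of `Γ_ns(p)` the conjugate is congruent to `1` modulo `p`, so `(g v)(g v)ᵗ` is integral. -/
theorem mul_mem_intRange_of_mem_Norm (hK : IsField K)
    (hC : ∀ g : GL (Fin 2) (ZMod p), g ∈ C ↔ (g : Matrix (Fin 2) (Fin 2) (ZMod p)) ∈ K)
    {g : SL(2, ℝ)} (hg : g ∈ Norm (levelGroup C)) (m n : ℤ) {X Y : ℝ}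
    (hX : X = g 0 0 * m + g 0 1 * n) (hY : Y = g 1 0 * m + g 1 1 * n) :
    X * X ∈ (Int.castRingHom ℝ).range ∧ X * Y ∈ (Int.castRingHom ℝ).range ∧
      Y * Y ∈ (Int.castRingHom ℝ).range := by
  obtain ⟨δ, hδ⟩ := exists_coe_eq_of_det_eq_one
    (A := !![1 - p * (m * n), p * (m * m); -(p * (n * n)), 1 + p * (m * n)])
    (by rw [Matrix.det_fin_two_of]; ring)
  have hδ1 : reduction p δ = 1 := by
    ext i j
    rw [reduction_apply, hδ]
    fin_cases i <;> fin_cases j <;> simp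
  have hδΓ : intToReal δ ∈ levelGroup C := intToReal_mem_levelGroup.2 (hδ1 ▸ C.one_mem)
  obtain ⟨ε, hε, hεg⟩ := (Subgroup.mem_normalizer_iff.1 hg _).1 hδΓ
  have hεC := (hC _).1 (Subgroup.mem_comap.1 hε)
  have hdet : g 0 0 * g 1 1 - g 0 1 * g 1 0 = 1 := by
    rw [← Matrix.det_fin_two]; exact g.2
  have hentry (i j : Fin 2) : (ε i j : ℝ) =
      ((g : Matrix (Fin 2) (Fin 2) ℝ) * (intToReal δ : Matrix (Fin 2) (Fin 2) ℝ) *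
        (g : Matrix (Fin 2) (Fin 2) ℝ).adjugate) i j := by
    rw [← intToReal_apply, hεg]; simp
  simp only [Matrix.mul_apply, Fin.sum_univ_two, Matrix.adjugate_fin_two, intToReal_apply, hδ]
    at hentry
  have h00 : (ε 0 0 : ℝ) = 1 - p * (X * Y) := by
    rw [hentry, hX, hY]; simp; linear_combination hdet
  have h01 : (ε 0 1 : ℝ) = p * (X * X) := by
    rw [hentry, hX]; simp; ring
  have h10 : (ε 1 0 : ℝ) = -(p * (Y * Y)) := by
    rw [hentry, hY]; simp; ring
  have h11 : (ε 1 1 : ℝ) = 1 + p * (X * Y) := by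
    rw [hentry, hX, hY]; simp; linear_combination hdet
  have htr : ε 0 0 + ε 1 1 = 2 := by
    have : (ε 0 0 + ε 1 1 : ℝ) = 2 := by rw [h00, h11]; ring
    exact_mod_cast this
  have hε1 := eq_one_of_trace_eq_two hK hεC (det_reduction ε) (by
    rw [Matrix.trace_fin_two, reduction_apply, reduction_apply]
    exact_mod_cast congrArg (Int.cast : ℤ → ZMod p) htr)
  have hmod (i j : Fin 2) :
      (p : ℤ) ∣ ε i j - (1 : Matrix (Fin 2) (Fin 2) ℤ) i j := by
    rw [← ZMod.intCast_zmod_eq_zero_iff_dvd, Int.cast_sub, ← reduction_apply, hε1, sub_eq_zero]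
    fin_cases i <;> fin_cases j <;> simp
  have hp : (p : ℝ) ≠ 0 := Nat.cast_ne_zero.2 (Fact.out : p.Prime).ne_zero
  obtain ⟨a, ha⟩ := hmod 0 0
  obtain ⟨b, hb⟩ := hmod 0 1
  obtain ⟨c, hc⟩ := hmod 1 0
  replace ha : (ε 0 0 : ℝ) - 1 = p * a := by exact_mod_cast ha
  replace hb : (ε 0 1 : ℝ) = p * b := by simp at hb; exact_mod_cast hb
  replace hc : (ε 1 0 : ℝ) = p * c := by simp at hc; exact_mod_cast hc
  refine ⟨⟨b, ?_⟩, ⟨-a, ?_⟩, ⟨-c, ?_⟩⟩ <;> apply mul_left_cancel₀ hp <;>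
    simp only [eq_intCast, Int.cast_neg]
  · linear_combination h01 - hb
  · linear_combination ha - h00
  · linear_combination hc - h10

/-- Products of two entries of `g` in the same column are integral by the case of the vectors
`(1, 0)` and `(0, 1)`, products of two entries in the same row by that case for `g⁻¹`, and the products
along the two diagonals by the case of `(1, 1)`. -/
theorem Norm_le_range (hK : IsField K)
    (hC : ∀ g : GL (Fin 2) (ZMod p), g ∈ C ↔ (g : Matrix (Fin 2) (Fin 2) (ZMod p)) ∈ K) :
    Norm (levelGroup C) ≤ intToReal.range := by
  intro g hg
  have hdet : g 0 0 * g 1 1 - g 0 1 * g 1 0 = 1 := by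
    rw [← Matrix.det_fin_two]; exact g.2
  obtain ⟨haa, hac, hcc⟩ := mul_mem_intRange_of_mem_Norm hK hC hg 1 0
    (X := g 0 0) (Y := g 1 0) (by simp) (by simp)
  obtain ⟨hbb, hbd, hdd⟩ := mul_mem_intRange_of_mem_Norm hK hC hg 0 1
    (X := g 0 1) (Y := g 1 1) (by simp) (by simp)
  obtain ⟨-, hdc, -⟩ := mul_mem_intRange_of_mem_Norm hK hC (inv_mem hg) (-1) 0
    (X := -g 1 1) (Y := g 1 0) (by simp [Matrix.adjugate_fin_two])
    (by simp [Matrix.adjugate_fin_two])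
  obtain ⟨-, hba, -⟩ := mul_mem_intRange_of_mem_Norm hK hC (inv_mem hg) 0 1
    (X := -g 0 1) (Y := g 0 0) (by simp [Matrix.adjugate_fin_two])
    (by simp [Matrix.adjugate_fin_two])
  obtain ⟨-, hs, -⟩ := mul_mem_intRange_of_mem_Norm hK hC hg 1 1
    (X := g 0 0 + g 0 1) (Y := g 1 0 + g 1 1) (by simp) (by simp)
  rw [neg_mul, neg_mem_iff] at hdc hba
  have h1 : (1 : ℝ) ∈ (Int.castRingHom ℝ).range := one_mem _
  have had : g 0 0 * g 1 1 ∈ (Int.castRingHom ℝ).range := by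
    refine mem_intRange_of_two_mul ?_ ?_
    · have e : 2 * (g 0 0 * g 1 1) = (g 0 0 + g 0 1) * (g 1 0 + g 1 1) - g 0 0 * g 1 0 -
          g 0 1 * g 1 1 + 1 := by linear_combination hdet
      rw [e]
      exact add_mem (sub_mem (sub_mem hs hac) hbd) h1
    · have e : g 0 0 * g 1 1 * (g 0 0 * g 1 1) = g 0 0 * g 0 0 * (g 1 1 * g 1 1) := by ring
      rw [e]
      exact mul_mem haa hdd
  have hbc : g 0 1 * g 1 0 ∈ (Int.castRingHom ℝ).range := by
    have e : g 0 1 * g 1 0 = g 0 0 * g 1 1 - 1 := by linear_combination -hdet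
    rw [e]
    exact sub_mem had h1
  apply mem_range_intToReal
  have hcomm {x y : ℝ} (h : x * y ∈ (Int.castRingHom ℝ).range) :
      y * x ∈ (Int.castRingHom ℝ).range := mul_comm x y ▸ h
  intro i j k l
  fin_cases i <;> fin_cases j <;> fin_cases k <;> fin_cases l <;>
    first | assumption | (apply hcomm; assumption)

/-- A norm one element `x ∉ 𝔽_p` of `K` lifts to `Γ_ns(p)`, and `𝔽_p[x] = K`; so an integral matrix
normalizing `Γ_ns(p)` normalizes `K` modulo `p`. -/
theorem Norm_levelGroup_eq (hK : IsField K) (hcard : Nat.card K = p ^ 2)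
    (hC : ∀ g : GL (Fin 2) (ZMod p), g ∈ C ↔ (g : Matrix (Fin 2) (Fin 2) (ZMod p)) ∈ K) :
    Norm (levelGroup C) = levelGroup (Subgroup.normalizer (C : Set (GL (Fin 2) (ZMod p)))) := by
  apply le_antisymm
  · intro g hg
    obtain ⟨γ, rfl⟩ := Norm_le_range hK hC hg
    rw [intToReal_mem_levelGroup]
    obtain ⟨x, hxK, hx, hxdet⟩ := exists_mem_det_eq_one hK hcard
    obtain ⟨δ, rfl⟩ := exists_reduction_eq hxdet
    have h := (Subgroup.mem_normalizer_iff.1 hg (intToReal δ)).1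
      (intToReal_mem_levelGroup.2 ((hC _).2 hxK))
    rw [← map_inv, ← map_mul, ← map_mul, intToReal_mem_levelGroup, map_mul, map_mul, map_inv, hC,
      Units.val_mul, Units.val_mul] at h
    exact mem_normalizer_of_conj_mem hK hC _ hxK hx h
  · exact (Subgroup.map_mono (Subgroup.le_normalizer_comap _)).trans (Subgroup.le_normalizer_map _)

theorem exists_reduction_mem_normalizer_notMem (hK : IsField K) (hcard : Nat.card K = p ^ 2)
    (hC : ∀ g : GL (Fin 2) (ZMod p), g ∈ C ↔ (g : Matrix (Fin 2) (Fin 2) (ZMod p)) ∈ K) :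
    ∃ γ : SL(2, ℤ), reduction p γ ∈ Subgroup.normalizer (C : Set (GL (Fin 2) (ZMod p))) ∧
      reduction p γ ∉ C := by
  obtain ⟨y, hyK, hy⟩ := exists_mem_apply_one_zero_ne_zero hK hcard
  obtain ⟨g, hgdet, hgy⟩ := exists_det_eq_one_mul_eq_adjugate_mul hK hyK hy
  obtain ⟨γ, rfl⟩ := exists_reduction_eq hgdet
  refine ⟨γ, mem_normalizer_of_conj_mem hK hC _ hyK hy ?_, fun h => ?_⟩
  · rw [hgy, Units.mul_inv_cancel_right]
    exact adjugate_mem hyK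
  · rw [mul_comm_of_isField hK ((hC _).1 h) hyK] at hgy
    exact ne_adjugate hK hyK hy ((Units.mul_left_inj _).1 hgy)

/-- Conjugation by an element of `N(C) \ C` is the non-trivial automorphism of `K`. -/
theorem mul_eq_adjugate_mul_of_mem_normalizer (hK : IsField K)
    (hC : ∀ g : GL (Fin 2) (ZMod p), g ∈ C ↔ (g : Matrix (Fin 2) (Fin 2) (ZMod p)) ∈ K)
    {y : Matrix (Fin 2) (Fin 2) (ZMod p)} (hyK : y ∈ K) (hy : y 1 0 ≠ 0)
    {g : GL (Fin 2) (ZMod p)} (hg : g ∈ Subgroup.normalizer (C : Set (GL (Fin 2) (ZMod p))))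
    (hgC : g ∉ C) : (g : Matrix (Fin 2) (Fin 2) (ZMod p)) * y = y.adjugate * g := by
  let u : GL (Fin 2) (ZMod p) := .mkOfDetNeZero y (det_ne_zero_of_mem hK hyK hy)
  have hu : (u : Matrix (Fin 2) (Fin 2) (ZMod p)) = y := rfl
  have hconj := (hC _).1 ((Subgroup.mem_normalizer_iff.1 hg u).1 ((hC u).2 hyK))
  rw [Units.val_mul, Units.val_mul, hu] at hconj
  rcases eq_or_eq_adjugate hK hyK hconj (Matrix.trace_units_conj g y) (Matrix.det_units_conj g y)
    with h | h
  · refine absurd ((hC g).2 (mem_of_commute hyK hy ?_)) hgC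
    rwa [Units.mul_inv_eq_iff_eq_mul] at h
  · rwa [Units.mul_inv_eq_iff_eq_mul] at h

/-- The group `N(C) / C` has order `2`. -/
theorem inv_mul_mem_of_mem_normalizer (hK : IsField K) (hcard : Nat.card K = p ^ 2)
    (hC : ∀ g : GL (Fin 2) (ZMod p), g ∈ C ↔ (g : Matrix (Fin 2) (Fin 2) (ZMod p)) ∈ K)
    {g h : GL (Fin 2) (ZMod p)} (hg : g ∈ Subgroup.normalizer (C : Set (GL (Fin 2) (ZMod p))))
    (hgC : g ∉ C) (hh : h ∈ Subgroup.normalizer (C : Set (GL (Fin 2) (ZMod p)))) (hhC : h ∉ C) :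
    g⁻¹ * h ∈ C := by
  obtain ⟨y, hyK, hy⟩ := exists_mem_apply_one_zero_ne_zero hK hcard
  have h1 := mul_eq_adjugate_mul_of_mem_normalizer hK hC hyK hy hg hgC
  have h2 := mul_eq_adjugate_mul_of_mem_normalizer hK hC hyK hy hh hhC
  refine (hC _).2 (mem_of_commute hyK hy ?_)
  rw [Units.val_mul, mul_assoc, h2, Units.inv_mul_eq_iff_eq_mul, ← mul_assoc, ← mul_assoc, h1,
    Units.mul_inv_cancel_right]

end Normalizer

/-! ### Faithfulness of the action on the curve -/

/-- The point `t i` with `t² = √2`. An integral matrix `[[a, b], [c, d]]` fixes it only if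
`-c t² = b` and `a t = d t`. -/
theorem exists_eq_one_or_eq_neg_one_of_smul_eq : ∃ τ : UpperHalfPlane, ∀ γ : SL(2, ℤ),
    intToReal γ • τ = τ → γ = 1 ∨ γ = -1 := by
  have hs : 0 < √(√2) := by positivity
  refine ⟨⟨⟨0, √(√2)⟩, hs⟩, fun γ h => ?_⟩
  have h1 := congrArg (fun z : UpperHalfPlane => (z : ℂ)) h
  have hne := UpperHalfPlane.denom_ne_zero (intToReal γ : GL (Fin 2) ℝ) ⟨⟨0, √(√2)⟩, hs⟩
  simp only [UpperHalfPlane.denom, Matrix.SpecialLinearGroup.toGL] at hne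
  simp only [UpperHalfPlane.coe_specialLinearGroup_apply, intToReal_apply] at h1
  rw [div_eq_iff (by simpa [intToReal_apply] using hne)] at h1
  have hre := congrArg Complex.re h1
  have him := congrArg Complex.im h1
  simp at hre him
  have hdet : γ 0 0 * γ 1 1 - γ 0 1 * γ 1 0 = 1 := by
    rw [← Matrix.det_fin_two]; exact γ.2
  have had : γ 0 0 = γ 1 1 := by
    have : (γ 0 0 : ℝ) = γ 1 1 := by
      rw [mul_comm] at him
      exact mul_left_cancel₀ hs.ne' him
    exact_mod_cast this
  have hc : γ 1 0 = 0 := by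
    by_contra hc
    have h2 : √2 * (γ 1 0 : ℝ) = -γ 0 1 := by
      have := Real.mul_self_sqrt (Real.sqrt_nonneg 2)
      linear_combination -(γ 1 0 : ℝ) * this + hre
    exact (irrational_sqrt_two.mul_intCast hc) ⟨-γ 0 1, by push_cast; exact h2.symm⟩
  have hb : γ 0 1 = 0 := by
    rw [hc] at hre
    simpa using hre
  rw [hc, had, mul_zero, sub_zero] at hdet
  rcases mul_self_eq_one_iff.1 hdet with h | h
  · left
    ext i j
    fin_cases i <;> fin_cases j <;> simp [had, hb, hc, h]
  · right
    ext i j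
    fin_cases i <;> fin_cases j <;> simp [had, hb, hc, h]

theorem neg_one_mem_levelGroup {p : ℕ} {C : Subgroup (GL (Fin 2) (ZMod p))}
    {K : Subalgebra (ZMod p) (Matrix (Fin 2) (Fin 2) (ZMod p))}
    (hC : ∀ g : GL (Fin 2) (ZMod p), g ∈ C ↔ (g : Matrix (Fin 2) (Fin 2) (ZMod p)) ∈ K) :
    intToReal (-1) ∈ levelGroup C := by
  rw [intToReal_mem_levelGroup, hC]
  convert neg_mem K.one_mem using 1
  ext i j
  rw [reduction_apply]
  fin_cases i <;> fin_cases j <;> simp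

/-- An integral matrix which acts trivially on the curve maps a point with stabilizer `±1` into the
`Γ`-orbit of this point, so that it lies in `±Γ = Γ`. -/
theorem BtoAut_injective {Γ : Subgroup SL(2, ℝ)} (hΓ : Γ ≤ intToReal.range)
    (hN : Norm Γ ≤ intToReal.range) (hneg : intToReal (-1) ∈ Γ) :
    Function.Injective (BtoAut Γ) := by
  rw [injective_iff_map_eq_one]
  intro b hb
  induction b using QuotientGroup.induction_on with
  | H g =>
    rw [QuotientGroup.eq_one_iff, Subgroup.mem_subgroupOf]
    obtain ⟨τ, hτ⟩ := exists_eq_one_or_eq_neg_one_of_smul_eq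
    have h1 : inducedFun g (proj τ) = proj τ :=
      congrArg (fun φ : Aut Γ => (φ : Curve Γ ≃ₜ Curve Γ) (proj τ)) hb
    rw [inducedFun_proj] at h1
    obtain ⟨⟨⟨γ, hγN⟩, hγ⟩, h⟩ := Quotient.exact h1
    have h2 : γ • τ = (g : SL(2, ℝ)) • τ := ExtendedHalfPlane.pt.inj h
    obtain ⟨δ, hδ⟩ := hΓ (Subgroup.mem_subgroupOf.1 hγ)
    obtain ⟨ε, hε⟩ := hN g.2
    have h3 : intToReal (δ⁻¹ * ε) • τ = τ := by
      rw [map_mul, map_inv, mul_smul, hδ, hε, ← h2, inv_smul_smul]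
    have h4 : intToReal (δ⁻¹ * ε) ∈ Γ := by
      rcases hτ _ h3 with h | h
      · rw [h, map_one]; exact Γ.one_mem
      · rw [h]; exact hneg
    rw [map_mul, map_inv, hδ, hε] at h4
    exact (Subgroup.mul_mem_cancel_left _ (inv_mem (Subgroup.mem_subgroupOf.1 hγ))).1 h4

end ModularCurve

open ModularCurve in
theorem mainTheorem6 (p : ℕ) [Fact p.Prime] (C : Subgroup (GL (Fin 2) (ZMod p)))
    (hC : ModularCurve.IsNonsplitCartan C)
    (hgenus : 2 ≤ ModularCurve.genus (ModularCurve.levelGroup C)) :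
    -- the normalizer of `Γ_ns(p)` in `SL₂(ℝ)` is contained in `SL₂(ℤ)`
    ModularCurve.Norm (ModularCurve.levelGroup C) ≤ ModularCurve.intToReal.range ∧
    -- and consists of the matrices in `SL₂(ℤ)` whose reduction lies in the normalizer of `C`
    ModularCurve.Norm (ModularCurve.levelGroup C) =
      ModularCurve.levelGroup (Subgroup.normalizer (C : Set (GL (Fin 2) (ZMod p)))) ∧
    -- `B(X_ns(p))` embeds in `Aut(X_ns(p))`
    Function.Injective (ModularCurve.BtoAut (ModularCurve.levelGroup C)) ∧
    -- and is generated by the modular involution `w`, the common class of all matrices in `SL₂(ℤ)`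
    -- whose reduction lies in the normalizer of `C` but not in `C`
    ∃ w : ModularCurve.B (ModularCurve.levelGroup C),
      (∃ γ : SL(2, ℤ),
        ModularCurve.reduction p γ ∈ Subgroup.normalizer (C : Set (GL (Fin 2) (ZMod p))) ∧
        ModularCurve.reduction p γ ∉ C) ∧
      (∀ γ : SL(2, ℤ),
        ModularCurve.reduction p γ ∈ Subgroup.normalizer (C : Set (GL (Fin 2) (ZMod p))) →
        ModularCurve.reduction p γ ∉ C →
        ∃ h : ModularCurve.intToReal γ ∈ ModularCurve.Norm (ModularCurve.levelGroup C),
          (QuotientGroup.mk ⟨ModularCurve.intToReal γ, h⟩ :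
            ModularCurve.B (ModularCurve.levelGroup C)) = w) ∧
      orderOf w = 2 ∧
      Subgroup.zpowers w = ⊤ ∧
      (ModularCurve.BtoAut (ModularCurve.levelGroup C)).range =
        Subgroup.zpowers (ModularCurve.BtoAut (ModularCurve.levelGroup C) w) := by
  obtain ⟨K, hK, hcard, hCK⟩ := hC
  have hle := Norm_le_range hK hCK
  have heq := Norm_levelGroup_eq hK hcard hCK
  have hN {γ : SL(2, ℤ)} : intToReal γ ∈ ModularCurve.Norm (levelGroup C) ↔
      reduction p γ ∈ Subgroup.normalizer (C : Set (GL (Fin 2) (ZMod p))) := by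
    rw [heq, intToReal_mem_levelGroup]
  obtain ⟨γ₀, hγ₀, hγ₀C⟩ := exists_reduction_mem_normalizer_notMem hK hcard hCK
  set w : B (levelGroup C) := QuotientGroup.mk ⟨intToReal γ₀, hN.2 hγ₀⟩ with hw
  have hclass (γ : SL(2, ℤ))
      (hγ : reduction p γ ∈ Subgroup.normalizer (C : Set (GL (Fin 2) (ZMod p))))
      (hγC : reduction p γ ∉ C) :
      (QuotientGroup.mk ⟨intToReal γ, hN.2 hγ⟩ : B (levelGroup C)) = w := by
    rw [hw, eq_comm, QuotientGroup.eq, Subgroup.mem_subgroupOf]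
    change (intToReal γ₀)⁻¹ * intToReal γ ∈ levelGroup C
    rw [← map_inv, ← map_mul, intToReal_mem_levelGroup, map_mul, map_inv]
    exact inv_mul_mem_of_mem_normalizer hK hcard hCK hγ₀ hγ₀C hγ hγC
  have hw1 : w ≠ 1 := by
    rw [hw, Ne, QuotientGroup.eq_one_iff, Subgroup.mem_subgroupOf]
    exact fun h => hγ₀C (intToReal_mem_levelGroup.1 h)
  have hor (b : B (levelGroup C)) : b = 1 ∨ b = w := by
    induction b using QuotientGroup.induction_on with
    | H g =>
      obtain ⟨g, hg⟩ := g
      obtain ⟨γ, rfl⟩ := hle hg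
      by_cases hγC : reduction p γ ∈ C
      · left
        rw [QuotientGroup.eq_one_iff, Subgroup.mem_subgroupOf]
        exact intToReal_mem_levelGroup.2 hγC
      · exact Or.inr (hclass γ (hN.1 hg) hγC)
  have hw2 : w * w = 1 := (hor (w * w)).resolve_right fun h => hw1 (mul_eq_left.1 h)
  have htop : Subgroup.zpowers w = ⊤ := by
    rw [eq_top_iff]
    intro b _
    rcases hor b with rfl | rfl
    · exact one_mem _
    · exact Subgroup.mem_zpowers _
  refine ⟨hle, heq, BtoAut_injective (Subgroup.map_le_range _ _) hle
    (neg_one_mem_levelGroup hCK), w, ⟨γ₀, hγ₀, hγ₀C⟩,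
    fun γ hγ hγC => ⟨hN.2 hγ, hclass γ hγ hγC⟩, orderOf_eq_prime (by rw [pow_two, hw2]) hw1,
    htop, ?_⟩
  rw [← MonoidHom.map_zpowers, htop, MonoidHom.range_eq_map]
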